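/- A (distributive) p-algebra is a bounded distributive lattice with a unary operation ${}^*$ such that $x\wedge y=0\iff x\le y^*$. For a Boolean algebra $\mathbf B$ let $\overline{\mathbf B}$ be the p-algebra obtained from $\mathbf B$ by adding a new top element $1$, with $0^*=1$, $1^*=0$, and $x^*=\neg x$ for $x\in B\setminus\{0\}$. Let $\mathbf B_s=\mathbf 2^s$ be the Boolean algebra with $s$ atoms, and let $\mathrm{Pa}_n$ be the variety generated by $\overline{\mathbf B_n}$. Let $n\ge 1$ and $k\ge 0$ be integers, and let $\mathbf F_n(k)$ be the algebra free in $\mathrm{Pa}_n$ on the generators $x_1,\dots,x_k$. Write $\mathscr P(k)$ for the power set of $\{1,\dots,k\}$, and call a pair $(\mathcal T,L)$ admissible if $\mathcal T\subseteq\mathscr P(k)$, $0<|\mathcal T|\le n$ and $L\subseteq\bigcap\mathcal T$. For an admissible pair $(\mathcal T,L)$ with $\mathcal T=\{T_1,\dots,T_s\}$, let $\mu^L_{\mathcal T}$ be the kernel of the homomorphism $\mathbf F_n(k)\to\overline{\mathbf B_s}$ that sends $x_i$ to $1$ if $i\in L$, and otherwise to the tuple $(\varepsilon_1,\dots,\varepsilon_s)\in\mathbf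 2^s$ with $\varepsilon_j=1$ if $i\in T_j$ and $\varepsilon_j=0$ if $i\notin T_j$. For $T\in\mathscr P(k)$ put $x_T=\bigwedge_{i\in T}x_i\wedge\bigwedge_{i\notin T}x_i^*$, and let $$p^L_{\mathcal T}=\Bigl(\bigvee_{T\in\mathcal T}x_T\Bigr)^{**}\wedge\bigwedge_{i\in L}x_i .$$ For a p-algebra $\mathbf A$ let $\mathrm{cm}(\mathbf A)$ be the set of completely meet-irreducible congruences of $\mathbf A$, quasi-ordered by $\mu\le^{\mathrm{Cm}}\nu\iff 1/\mu\subseteq 1/\nu$, where $1/\mu$ is the congruence class of $1$. Let $\mathcal F_p(\mathbf A)$ be the set of prime filters and $\mathcal J(\mathbf A)$ the set of join-irreducible elements of $\mathbf A$. For a (quasi-)ordered set $X$ let $\mathrm{Up}(X)$ be the p-algebra of its up-sets, with union, intersection, and $U^*=X\setminus{\downarrow}U$. Theorem (Structure of free p-algebras). The following hold. 1. $\mathrm{cm}(\mathbf F_n(k))=\{\mu^L_{\mathcal T}:(\mathcal T,L)\text{ admissible}\}$. 2. For all admissible pairs $(\mathcal T,L)$ and $(\mathcal S,K)$: $\mu^L_{\mathcal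 T}\le^{\mathrm{Cm}}\mu^K_{\mathcal S}\iff \mathcal S\subseteq\mathcal T$ and $L\subseteq K$. 3. $\mathcal J(\mathbf F_n(k))=\{p^L_{\mathcal T}:(\mathcal T,L)\text{ admissible}\}$, and there are isomorphisms of p-algebras $$\mathbf F_n(k)\cong\mathrm{Up}(\mathcal F_p(\mathbf F_n(k)),\subseteq)\cong\mathrm{Up}(\mathrm{cm}(\mathbf F_n(k)),\le^{\mathrm{Cm}})\cong\mathrm{Up}(\mathcal J(\mathbf F_n(k)),\ge).$$ -/

import Mathlib

/-! ### Distributive p-algebras -/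

/-- A (distributive) p-algebra: a bounded distributive lattice with a unary operation `ᶜ`
(the pseudo-complement, usually written as a star). -/
class PAlgebra (A : Type*) extends DistribLattice A, BoundedOrder A, Compl A where
  le_compl_iff' : ∀ x y : A, x ≤ yᶜ ↔ x ⊓ y = ⊥

namespace PAlg

/-- Homomorphisms of p-algebras: maps that preserve all the fundamental operations. -/
structure Hom (A B : Type*) [PAlgebra A] [PAlgebra B] where
  toFun : A → B
  map_bot : toFun ⊥ = ⊥
  map_top : toFun ⊤ = ⊤
  map_inf : ∀ a b, toFun (a ⊓ b) = toFun a ⊓ toFun b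
  map_sup : ∀ a b, toFun (a ⊔ b) = toFun a ⊔ toFun b
  map_compl : ∀ a, toFun aᶜ = (toFun a)ᶜ

/-- Isomorphism of p-algebras. -/
def Iso (A B : Type*) [PAlgebra A] [PAlgebra B] : Prop :=
  ∃ h : Hom A B, Function.Bijective h.toFun

/-! ### Congruences -/

/-- Congruences of a p-algebra. -/
structure Con (A : Type*) [PAlgebra A] where
  rel : A → A → Prop
  iseqv : Equivalence rel
  inf : ∀ {a b c d}, rel a b → rel c d → rel (a ⊓ c) (b ⊓ d)
  sup : ∀ {a b c d}, rel a b → rel c d → rel (a ⊔ c) (b ⊔ d)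
  compl : ∀ {a b}, rel a b → rel aᶜ bᶜ

namespace Con

variable {A : Type*} [PAlgebra A]

theorem rel_injective : Function.Injective (Con.rel : Con A → A → A → Prop) := by
  rintro ⟨r, _, _, _, _⟩ ⟨s, _, _, _, _⟩ h
  cases h
  rfl

/-- Congruences are ordered by inclusion. -/
instance : PartialOrder (Con A) := PartialOrder.lift Con.rel rel_injective

instance : InfSet (Con A) where
  sInf S :=
    { rel := fun a b => ∀ φ ∈ S, φ.rel a b
      iseqv := ⟨fun a φ _ => φ.iseqv.refl a, fun h φ hφ => φ.iseqv.symm (h φ hφ),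
        fun h h' φ hφ => φ.iseqv.trans (h φ hφ) (h' φ hφ)⟩
      inf := fun h h' φ hφ => φ.inf (h φ hφ) (h' φ hφ)
      sup := fun h h' φ hφ => φ.sup (h φ hφ) (h' φ hφ)
      compl := fun h φ hφ => φ.compl (h φ hφ) }

/-- The complete lattice of congruences: infima are intersections. -/
instance : CompleteLattice (Con A) :=
  completeLatticeOfInf (Con A) fun _ =>
    ⟨fun _ hφ _ _ h => h _ hφ, fun _ hψ a b h φ hφ => hψ hφ a b h⟩

/-- The congruence class of `1`. -/
def oneClass (μ : Con A) : Set A := {a | μ.rel a ⊤}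

/-- The kernel of a homomorphism. -/
def ker {B : Type*} [PAlgebra B] (h : Hom A B) : Con A where
  rel a b := h.toFun a = h.toFun b
  iseqv := ⟨fun _ => rfl, Eq.symm, Eq.trans⟩
  inf h₁ h₂ := by rw [h.map_inf, h.map_inf, h₁, h₂]
  sup h₁ h₂ := by rw [h.map_sup, h.map_sup, h₁, h₂]
  compl h₁ := by rw [h.map_compl, h.map_compl, h₁]

end Con

/-- `μ` is completely meet-irreducible: whenever `μ` is the meet of a set of elements, it belongs
to that set. (The top element is excluded, being the meet of the empty set.) -/
def CompletelyMeetIrred {α : Type*} [CompleteLattice α] (μ : α) : Prop :=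
  ∀ S : Set α, sInf S = μ → μ ∈ S

/-- The set of completely meet-irreducible congruences of `A`, to be ordered by inclusion
of the classes of `1`. -/
structure Cm (A : Type*) [PAlgebra A] where
  con : Con A
  irred : CompletelyMeetIrred con

/-- The order on completely meet-irreducible congruences: `μ ≤ ν` iff `1/μ ⊆ 1/ν`. -/
instance (A : Type*) [PAlgebra A] : Preorder (Cm A) :=
  Preorder.lift fun μ => μ.con.oneClass

/-- The prime filters of `A`, ordered by inclusion. -/
abbrev PrimeFilter (A : Type*) [PAlgebra A] : Type _ :=
  {F : Order.PFilter A // F.IsPrime}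

/-- The join-irreducible elements of `A`, with the order induced from `A`. -/
abbrev JoinIrred (A : Type*) [PAlgebra A] : Type _ :=
  {a : A // SupIrred a}

/-! ### The p-algebra of up-sets -/

/-- The up-sets of `X`, ordered by inclusion. -/
def Up (X : Type*) [Preorder X] : Type _ := {U : Set X // IsUpperSet U}

namespace Up

variable {X : Type*} [Preorder X]

/-- Union and intersection are the lattice operations. -/
instance : DistribLattice (Up X) :=
  Subtype.distribLattice (P := fun U : Set X => IsUpperSet U)
    (fun _ _ hU hV => hU.union hV) (fun _ _ hU hV => hU.inter hV)

/-- The pseudo-complement of `U` is the complement of the down-set generated by `U`. -/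
instance : PAlgebra (Up X) where
  top := ⟨Set.univ, isUpperSet_univ⟩
  bot := ⟨∅, isUpperSet_empty⟩
  le_top U := Set.subset_univ U.1
  bot_le U := Set.empty_subset U.1
  compl U := ⟨(lowerClosure U.1 : Set X)ᶜ, (lowerClosure U.1).lower.compl⟩
  le_compl_iff' U V := by
    constructor
    · intro h
      apply Subtype.ext
      refine Set.eq_empty_of_forall_notMem ?_
      rintro x ⟨hU, hV⟩
      exact h hU (subset_lowerClosure hV)
    · rintro h x hx ⟨y, hy, hxy⟩
      have h' : U.1 ∩ V.1 = ∅ := congrArg Subtype.val h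
      have : y ∈ U.1 ∩ V.1 := ⟨U.2 hxy hx, hy⟩
      rw [h'] at this
      exact this

end Up

/-! ### The subdirectly irreducible p-algebras -/

open Classical in
/-- For a Boolean algebra `B`, the p-algebra obtained by adding a new top element to `B`. -/
noncomputable instance overline (B : Type*) [BooleanAlgebra B] : PAlgebra (WithTop B) where
  compl x := match x with
    | ⊤ => ⊥
    | (b : B) => if b = ⊥ then ⊤ else ((bᶜ : B) : WithTop B)
  le_compl_iff' x y := by
    induction y with
    | top => exact (by simp : x ≤ ⊥ ↔ x ⊓ ⊤ = ⊥)
    | coe b =>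
      change x ≤ (if b = ⊥ then ⊤ else ((bᶜ : B) : WithTop B)) ↔ _
      split_ifs with hb
      · subst hb
        simp
      · induction x with
        | top => simp [hb]
        | coe a =>
          rw [WithTop.coe_le_coe, ← WithTop.coe_inf, ← WithTop.coe_bot, WithTop.coe_inj,
            le_compl_iff_disjoint_right, disjoint_iff]

/-- The p-algebra obtained by adding a new top to the Boolean algebra of subsets of `ι`. -/
abbrev BBar (ι : Type*) : Type _ := WithTop (Set ι)

theorem compl_top' {B : Type*} [BooleanAlgebra B] : (⊤ : WithTop B)ᶜ = ⊥ := rfl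

open Classical in
theorem compl_coe' {B : Type*} [BooleanAlgebra B] (b : B) :
    ((b : WithTop B))ᶜ = if b = ⊥ then ⊤ else ((bᶜ : B) : WithTop B) := rfl

/-! ### Terms, identities, the varieties -/

/-- Terms in the language of p-algebras with variables from `α`. -/
inductive Term (α : Type*) where
  | var : α → Term α
  | bot : Term α
  | top : Term α
  | inf : Term α → Term α → Term α
  | sup : Term α → Term α → Term α
  | compl : Term α → Term α

namespace Term

variable {α β : Type*} {A B : Type*} [PAlgebra A] [PAlgebra B]

/-- The value of a term under an assignment. -/
def eval (v : α → A) : Term α → A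
  | var i => v i
  | bot => ⊥
  | top => ⊤
  | inf s t => s.eval v ⊓ t.eval v
  | sup s t => s.eval v ⊔ t.eval v
  | compl t => (t.eval v)ᶜ

/-- Substitution. -/
def subst (σ : α → Term β) : Term α → Term β
  | var i => σ i
  | bot => bot
  | top => top
  | inf s t => inf (s.subst σ) (t.subst σ)
  | sup s t => sup (s.subst σ) (t.subst σ)
  | compl t => compl (t.subst σ)

theorem eval_subst (σ : α → Term β) (v : β → A) (t : Term α) :
    (t.subst σ).eval v = t.eval (fun i => (σ i).eval v) := by
  induction t <;> simp_all [subst, eval]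

theorem map_eval (h : Hom A B) (v : α → A) (t : Term α) :
    h.toFun (t.eval v) = t.eval (fun i => h.toFun (v i)) := by
  induction t <;> simp_all [eval, h.map_bot, h.map_top, h.map_inf, h.map_sup, h.map_compl]

end Term

/-- The identity `s ≈ t` holds in `A`. -/
def Satisfies (A : Type*) [PAlgebra A] {α : Type*} (s t : Term α) : Prop :=
  ∀ v : α → A, s.eval v = t.eval v

/-- Membership in `Pa_n`, the variety generated by the p-algebra `BBar (Fin n)`: all the identities
that hold in `BBar (Fin n)` hold in `A`. -/
def InPa (n : ℕ) (A : Type*) [PAlgebra A] : Prop :=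
  ∀ (m : ℕ) (s t : Term (Fin m)), Satisfies (BBar (Fin n)) s t → Satisfies A s t

/-- `BBar ι` belongs to `Pa_n` if `ι` is nonempty with at most `n` elements. -/
theorem inPa_bBar {n : ℕ} {ι : Type*} [Fintype ι] [Nonempty ι] (h : Fintype.card ι ≤ n) :
    InPa n (BBar ι) := by
  classical
  obtain ⟨f⟩ : Nonempty (ι ↪ Fin n) :=
    Function.Embedding.nonempty_of_card_le (by simpa using h)
  have hg : Function.Surjective (Function.invFun f) := Function.invFun_surjective f.injective
  set g := Function.invFun f
  have hinj : Function.Injective (Set.preimage g) := hg.preimage_injective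
  let φ : Hom (BBar ι) (BBar (Fin n)) :=
    { toFun := WithTop.map (Set.preimage g)
      map_bot := rfl
      map_top := rfl
      map_inf := fun a b => by
        induction a using WithTop.recTopCoe <;> induction b using WithTop.recTopCoe <;> rfl
      map_sup := fun a b => by
        induction a using WithTop.recTopCoe <;> induction b using WithTop.recTopCoe <;> rfl
      map_compl := fun a => by
        induction a using WithTop.recTopCoe with
        | top => rfl
        | coe a =>
          rw [WithTop.map_coe, compl_coe', compl_coe']
          have : Set.preimage g a = ⊥ ↔ a = ⊥ := by
            constructor
            · intro h
              exact hinj (h.trans Set.preimage_empty.symm)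
            · rintro rfl
              rfl
          by_cases ha : a = ⊥
          · rw [if_pos ha, if_pos (this.2 ha)]
            rfl
          · rw [if_neg ha, if_neg (mt this.1 ha)]
            rfl }
  have hφ : Function.Injective φ.toFun := WithTop.map_injective hinj
  intro m s t hst v
  apply hφ
  rw [Term.map_eval, Term.map_eval]
  exact hst _

/-! ### The free algebras -/

/-- Two terms are identified iff their equality is an identity of `Pa_n`. -/
def freeSetoid (n k : ℕ) : Setoid (Term (Fin k)) where
  r s t := Satisfies (BBar (Fin n)) s t
  iseqv := ⟨fun _ _ => rfl, fun h v => (h v).symm, fun h h' v => (h v).trans (h' v)⟩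

/-- The `k`-generated free algebra in `Pa_n`: terms in `k` variables modulo the identities
of `Pa_n`. -/
def Free (n k : ℕ) : Type := Quotient (freeSetoid n k)

namespace Free

variable {n k : ℕ}

/-- The element represented by a term. -/
def mk (t : Term (Fin k)) : Free n k := Quotient.mk (freeSetoid n k) t

theorem mk_eq {s t : Term (Fin k)} :
    (mk s : Free n k) = mk t ↔ Satisfies (BBar (Fin n)) s t := Quotient.eq (r := freeSetoid n k)

theorem exists_rep (a : Free n k) : ∃ t, mk t = a := Quotient.exists_rep a

/-- The term function on `BBar (Fin n)` of an element. -/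
noncomputable def toTermFun : Free n k → (Fin k → BBar (Fin n)) → BBar (Fin n) :=
  Quotient.lift (fun t v => t.eval v) fun _ _ h => funext h

theorem toTermFun_injective :
    Function.Injective (toTermFun : Free n k → (Fin k → BBar (Fin n)) → BBar (Fin n)) := by
  intro a b h
  obtain ⟨s, rfl⟩ := exists_rep a
  obtain ⟨t, rfl⟩ := exists_rep b
  exact mk_eq.2 fun v => congrFun h v

/-- Lattice operations come from terms; `a ≤ b` iff it holds under every evaluation
in `BBar (Fin n)`. -/
noncomputable instance : DistribLattice (Free n k) :=
  letI : Max (Free n k) := ⟨Quotient.map₂ Term.sup fun _ _ h _ _ h' v =>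
    congrArg₂ (· ⊔ ·) (h v) (h' v)⟩
  letI : Min (Free n k) := ⟨Quotient.map₂ Term.inf fun _ _ h _ _ h' v =>
    congrArg₂ (· ⊓ ·) (h v) (h' v)⟩
  letI : LE (Free n k) := ⟨fun a b => toTermFun a ≤ toTermFun b⟩
  letI : LT (Free n k) := ⟨fun a b => toTermFun a < toTermFun b⟩
  toTermFun_injective.distribLattice toTermFun Iff.rfl Iff.rfl
    (fun a b => by
      obtain ⟨s, rfl⟩ := exists_rep a
      obtain ⟨t, rfl⟩ := exists_rep b
      rfl)
    (fun a b => by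
      obtain ⟨s, rfl⟩ := exists_rep a
      obtain ⟨t, rfl⟩ := exists_rep b
      rfl)

theorem mk_inf (s t : Term (Fin k)) : (mk (s.inf t) : Free n k) = mk s ⊓ mk t := rfl

theorem mk_sup (s t : Term (Fin k)) : (mk (s.sup t) : Free n k) = mk s ⊔ mk t := rfl

theorem mk_le {s t : Term (Fin k)} :
    (mk s : Free n k) ≤ mk t ↔ ∀ v : Fin k → BBar (Fin n), s.eval v ≤ t.eval v := Iff.rfl

noncomputable instance : PAlgebra (Free n k) where
  top := mk Term.top
  bot := mk Term.bot
  le_top a := by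
    obtain ⟨s, rfl⟩ := exists_rep a
    exact mk_le.2 fun v => le_top
  bot_le a := by
    obtain ⟨s, rfl⟩ := exists_rep a
    exact mk_le.2 fun v => bot_le
  compl := Quotient.map Term.compl fun _ _ h v => congrArg (·ᶜ) (h v)
  le_compl_iff' a b := by
    obtain ⟨s, rfl⟩ := exists_rep a
    obtain ⟨t, rfl⟩ := exists_rep b
    change mk s ≤ mk t.compl ↔ mk (s.inf t) = mk Term.bot
    rw [mk_le, mk_eq]
    exact forall_congr' fun v => PAlgebra.le_compl_iff' _ _

/-- The free generators. -/
def gen (i : Fin k) : Free n k := mk (Term.var i)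

theorem eval_gen (t : Term (Fin k)) : t.eval (gen : Fin k → Free n k) = mk t := by
  induction t with
  | var i => rfl
  | bot => rfl
  | top => rfl
  | inf s t hs ht => rw [Term.eval, hs, ht, mk_inf]
  | sup s t hs ht => rw [Term.eval, hs, ht, mk_sup]
  | compl t ht => rw [Term.eval, ht]; rfl

/-- The free algebra belongs to the variety. -/
theorem inPa : InPa n (Free n k) := by
  intro m s t hst v
  choose σ hσ using fun i => exists_rep (v i)
  have hv : v = fun i => (σ i).eval (gen : Fin k → Free n k) :=
    funext fun i => by rw [eval_gen, hσ]
  rw [hv, ← Term.eval_subst, ← Term.eval_subst, eval_gen, eval_gen, mk_eq]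
  intro w
  rw [Term.eval_subst, Term.eval_subst]
  exact hst _

/-- The homomorphism that extends a map of the generators to an algebra of the variety. -/
noncomputable def lift {A : Type*} [PAlgebra A] (hA : InPa n A) (f : Fin k → A) : Hom (Free n k) A where
  toFun := Quotient.lift (fun t => t.eval f) fun s t h => hA k s t h f
  map_bot := rfl
  map_top := rfl
  map_inf a b := by
    obtain ⟨s, rfl⟩ := exists_rep a
    obtain ⟨t, rfl⟩ := exists_rep b
    rfl
  map_sup a b := by
    obtain ⟨s, rfl⟩ := exists_rep a
    obtain ⟨t, rfl⟩ := exists_rep b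
    rfl
  map_compl a := by
    obtain ⟨s, rfl⟩ := exists_rep a
    rfl

theorem lift_gen {A : Type*} [PAlgebra A] (hA : InPa n A) (f : Fin k → A) (i : Fin k) :
    (lift hA f).toFun (gen i) = f i := rfl

theorem lift_unique {A : Type*} [PAlgebra A] (hA : InPa n A) (f : Fin k → A)
    (h : Hom (Free n k) A) (hh : ∀ i, h.toFun (gen i) = f i) : h.toFun = (lift hA f).toFun := by
  funext a
  obtain ⟨t, rfl⟩ := exists_rep a
  rw [← eval_gen, Term.map_eval, Term.map_eval]
  simp only [hh, lift_gen]

end Free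

/-! ### The congruences `μ^L_𝒯` and the elements `p^L_𝒯` -/

/-- The admissible pairs: `0 < |𝒯| ≤ n` and `L ⊆ ⋂ 𝒯`, for sets `𝒯` of subsets of `Fin k`. -/
structure Admissible (n : ℕ) {k : ℕ} (𝒯 : Finset (Finset (Fin k))) (L : Finset (Fin k)) :
    Prop where
  pos : 0 < 𝒯.card
  le : 𝒯.card ≤ n
  sub : L ⊆ 𝒯.inf id

variable {n k : ℕ}

/-- The assignment of generators in `BBar 𝒯`: the `i`-th generator goes to the new top if `i ∈ L`
and otherwise to the tuple of the truth values of `i ∈ T`, for `T ∈ 𝒯`. -/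
def assign (𝒯 : Finset (Finset (Fin k))) (L : Finset (Fin k)) (i : Fin k) : BBar 𝒯 :=
  if i ∈ L then ⊤ else (({T | i ∈ T.1} : Set 𝒯) : WithTop (Set 𝒯))

theorem Admissible.inPa {𝒯 : Finset (Finset (Fin k))} {L : Finset (Fin k)}
    (h : Admissible n 𝒯 L) : InPa n (BBar 𝒯) :=
  haveI : Nonempty 𝒯 := (Finset.card_pos.1 h.pos).to_subtype
  inPa_bBar (by simpa using h.le)

/-- The congruence `μ^L_𝒯` of the free algebra. -/
noncomputable def mu {𝒯 : Finset (Finset (Fin k))} {L : Finset (Fin k)} (h : Admissible n 𝒯 L) :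
    Con (Free n k) :=
  Con.ker (Free.lift h.inPa (assign 𝒯 L))

/-- The element `x_T`, the meet of the `x_i` with `i ∈ T` and of the `x_iᶜ` with `i ∉ T`. -/
noncomputable def atomOf (n : ℕ) (T : Finset (Fin k)) : Free n k :=
  (T.inf fun i => Free.gen i) ⊓ (Tᶜ.inf fun i => (Free.gen i)ᶜ)

/-- The element `p^L_𝒯`. -/
noncomputable def pElem (n : ℕ) (𝒯 : Finset (Finset (Fin k))) (L : Finset (Fin k)) : Free n k :=
  (𝒯.sup fun T => atomOf n T)ᶜᶜ ⊓ L.inf fun i => Free.gen i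

end PAlg

/-!
Structure of the finitely generated free algebras of the varieties `Pa_n`.

Each admissible pair `x = (𝒯, L)` gives a homomorphism from the free algebra to `BBar 𝒯`, and `x`
is said to force `a` if this homomorphism sends `a` to `1`. With the order `(𝒯, L) ≤ (𝒮, K)` iff
`𝒮 ⊆ 𝒯` and `L ⊆ K`, the admissible pairs form a finite Kripke model: forcing is preserved upwards
(`AdmPair.Forces.mono`), it commutes with meets and joins, because `1` is join-irreducible in
`BBar 𝒯`, and `x` forces `aᶜ` iff no `y ≥ x` forces `a` (`AdmPair.forces_compl`). Behind this lies
the fact that a Boolean coordinate of the value of a term depends only on that coordinate of the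
assignment, so that it is read off from forcing at the maximal pairs `({T}, T)`.

The model is complete: an assignment in `BBar (Fin n)` behaves like the pair made of the set of its
Boolean coordinates and the set of generators sent to `1`, so an element is determined by the pairs
that force it (`AdmPair.eq_of_forces_iff`). The element `p^L_𝒯` is forced exactly on the principal
up-set of `(𝒯, L)` (`AdmPair.forces_pElem`). So the free algebra is isomorphic to the algebra of
up-sets of the finite ordered set of admissible pairs, and it remains to identify this ordered set
with three others (`iso_up_of_surjective`).

For join-irreducible elements and prime filters this is finite Birkhoff duality. For congruences,
the kernel of the homomorphism of `x` is the largest congruence for which the set of elements forced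
by `x` is a union of classes (`AdmPair.exists_forces_not_forces`). This gives a monolith in the
quotient (`AdmPair.completelyMeetIrred_con`). Conversely, two elements that a congruence `μ` does
not relate are separated by a kernel above `μ`: a minimal element that witnesses the failure is some
`p^L_𝒯` (`AdmPair.exists_le_con_of_not_rel`). So `μ` is an intersection of such kernels, and equals
one of them if it is completely meet-irreducible.
-/

namespace PAlg

/-! ### Coordinates in `BBar ι` -/

section BBar

variable {ι κ α : Type*}

/-- The `u`-th Boolean coordinate of an element of `BBar ι` is true: a subset of `ι` has to
contain `u`, and the new top satisfies this for all `u`. -/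
def Holds (u : ι) (a : BBar ι) : Prop := (({u} : Set ι) : BBar ι) ≤ a

theorem holds_coe {u : ι} {s : Set ι} : Holds u (s : BBar ι) ↔ u ∈ s := by
  rw [Holds, WithTop.coe_le_coe]
  exact Set.singleton_subset_iff

theorem holds_top (u : ι) : Holds u (⊤ : BBar ι) := le_top

theorem not_holds_bot (u : ι) : ¬Holds u (⊥ : BBar ι) := fun h =>
  holds_coe.1 (h : Holds u ((⊥ : Set ι) : BBar ι))

theorem holds_inf {u : ι} {a b : BBar ι} : Holds u (a ⊓ b) ↔ Holds u a ∧ Holds u b := le_inf_iff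

theorem holds_sup {u : ι} {a b : BBar ι} : Holds u (a ⊔ b) ↔ Holds u a ∨ Holds u b := by
  induction a using WithTop.recTopCoe with
  | top => simp [holds_top]
  | coe a =>
    induction b using WithTop.recTopCoe with
    | top => simp [holds_top]
    | coe b =>
      rw [← WithTop.coe_sup, holds_coe, holds_coe, holds_coe]
      rfl

theorem holds_compl {u : ι} {a : BBar ι} : Holds u aᶜ ↔ ¬Holds u a := by
  induction a using WithTop.recTopCoe with
  | top => simp [holds_top, compl_top', not_holds_bot]
  | coe a =>
    rw [compl_coe']
    split_ifs with h
    · subst h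
      exact iff_of_true (holds_top u) (not_holds_bot u)
    · rw [holds_coe, holds_coe]
      rfl

theorem eq_bot_iff_forall_not_holds [Nonempty ι] {a : BBar ι} : a = ⊥ ↔ ∀ u, ¬Holds u a := by
  induction a using WithTop.recTopCoe with
  | top =>
    refine iff_of_false (WithTop.coe_ne_top.symm : (⊤ : BBar ι) ≠ ((⊥ : Set ι) : BBar ι)) ?_
    exact fun h => h (Classical.arbitrary ι) (holds_top _)
  | coe a =>
    simp_rw [holds_coe, ← WithTop.coe_bot, WithTop.coe_inj]
    exact Set.eq_empty_iff_forall_notMem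

theorem compl_eq_top_iff [Nonempty ι] {a : BBar ι} : aᶜ = ⊤ ↔ ∀ u, ¬Holds u a := by
  rw [← eq_bot_iff_forall_not_holds, ← top_le_iff, PAlgebra.le_compl_iff', top_inf_eq]

/-- An element of `BBar ι` is determined by its coordinates, once the new top is told apart from
the top of the Boolean algebra. -/
theorem bBar_ext {a b : BBar ι} (ht : a = ⊤ ↔ b = ⊤) (h : ∀ u, Holds u a ↔ Holds u b) : a = b := by
  induction a using WithTop.recTopCoe with
  | top => exact (ht.1 rfl).symm
  | coe a =>
    induction b using WithTop.recTopCoe with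
    | top => exact ht.2 rfl
    | coe b => exact congrArg _ (Set.ext fun u => by simpa only [holds_coe] using h u)

theorem sup_eq_top_iff {a b : BBar ι} : a ⊔ b = ⊤ ↔ a = ⊤ ∨ b = ⊤ := by
  induction a using WithTop.recTopCoe <;> induction b using WithTop.recTopCoe <;>
    simp [← WithTop.coe_sup]

/-- A Boolean coordinate of the value of a term depends only on the same coordinate of the
assignment. -/
theorem holds_eval_congr {v : α → BBar ι} {w : α → BBar κ} {u : ι} {u' : κ}
    (h : ∀ i, Holds u (v i) ↔ Holds u' (w i)) (t : Term α) :
    Holds u (t.eval v) ↔ Holds u' (t.eval w) := by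
  induction t with
  | var i => exact h i
  | bot => exact iff_of_false (not_holds_bot u) (not_holds_bot u')
  | top => exact iff_of_true (holds_top u) (holds_top u')
  | inf s t hs ht => exact holds_inf.trans ((and_congr hs ht).trans holds_inf.symm)
  | sup s t hs ht => exact holds_sup.trans ((or_congr hs ht).trans holds_sup.symm)
  | compl t ht => exact holds_compl.trans ((not_congr ht).trans holds_compl.symm)

/-- Terms that take the value `1` keep it if coordinates are dropped (or repeated) and more
variables are sent to `1`. -/
theorem eval_eq_top_mono [Nonempty ι] [Nonempty κ] {v : α → BBar ι} {w : α → BBar κ}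
    (htop : ∀ i, v i = ⊤ → w i = ⊤)
    (h : ∀ u' : κ, ∃ u : ι, ∀ i, Holds u (v i) ↔ Holds u' (w i)) (t : Term α) :
    t.eval v = ⊤ → t.eval w = ⊤ := by
  induction t with
  | var i => exact htop i
  | bot =>
    intro (e : (⊥ : BBar ι) = ⊤)
    exact (not_holds_bot (Classical.arbitrary ι) (e ▸ holds_top _)).elim
  | top => exact fun _ => rfl
  | inf s t hs ht => exact fun e => inf_eq_top_iff.2 ((inf_eq_top_iff.1 e).imp hs ht)
  | sup s t hs ht => exact fun e => sup_eq_top_iff.2 ((sup_eq_top_iff.1 e).imp hs ht)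
  | compl t _ =>
    intro e
    refine compl_eq_top_iff.2 fun u' hu' => ?_
    obtain ⟨u, hu⟩ := h u'
    exact compl_eq_top_iff.1 e u ((holds_eval_congr hu t).2 hu')

end BBar

/-! ### Admissible pairs and forcing -/

/-- The admissible pairs `(𝒯, L)`, with `(𝒯, L) ≤ (𝒮, K)` iff `𝒮 ⊆ 𝒯` and `L ⊆ K`. -/
@[ext]
structure AdmPair (n k : ℕ) where
  sets : Finset (Finset (Fin k))
  ones : Finset (Fin k)
  adm : Admissible n sets ones

namespace AdmPair

variable {n k : ℕ}

instance : PartialOrder (AdmPair n k) where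
  le x y := y.sets ⊆ x.sets ∧ x.ones ⊆ y.ones
  le_refl _ := ⟨subset_rfl, subset_rfl⟩
  le_trans _ _ _ h h' := ⟨h'.1.trans h.1, h.2.trans h'.2⟩
  le_antisymm _ _ h h' := AdmPair.ext (h'.1.antisymm h.1) (h.2.antisymm h'.2)

instance : Finite (AdmPair n k) :=
  Finite.of_injective (fun x : AdmPair n k => (x.sets, x.ones)) fun _ _ h =>
    AdmPair.ext (congrArg Prod.fst h) (congrArg Prod.snd h)

noncomputable instance : Fintype (AdmPair n k) := Fintype.ofFinite _

instance (x : AdmPair n k) : Nonempty x.sets := (Finset.card_pos.1 x.adm.pos).to_subtype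

theorem mem_of_mem_ones (x : AdmPair n k) {T : Finset (Fin k)} (hT : T ∈ x.sets) {i : Fin k}
    (hi : i ∈ x.ones) : i ∈ T :=
  (Finset.inf_le (f := id) hT : x.sets.inf id ≤ T) (x.adm.sub hi)

/-- The homomorphism from the free algebra to `BBar 𝒯` whose kernel is `μ^L_𝒯`. -/
noncomputable def hom (x : AdmPair n k) : Hom (Free n k) (BBar x.sets) :=
  Free.lift x.adm.inPa (assign x.sets x.ones)

theorem assign_eq_top {𝒯 : Finset (Finset (Fin k))} {L : Finset (Fin k)} {i : Fin k} :
    assign 𝒯 L i = ⊤ ↔ i ∈ L := by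
  unfold assign
  split_ifs with h <;> simp [h]

theorem holds_assign (x : AdmPair n k) (T : x.sets) (i : Fin k) :
    Holds T (assign x.sets x.ones i) ↔ i ∈ T.1 := by
  unfold assign
  split_ifs with h
  · exact iff_of_true (holds_top T) (x.mem_of_mem_ones T.2 h)
  · exact holds_coe

/-- The pair `({T}, T)`. These pairs are the maximal ones. -/
def single (hn : 1 ≤ n) (T : Finset (Fin k)) : AdmPair n k where
  sets := {T}
  ones := T
  adm := ⟨by simp, by simpa using hn, by simp⟩

theorem le_single_iff {hn : 1 ≤ n} {x : AdmPair n k} {T : Finset (Fin k)} :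
    x ≤ single hn T ↔ T ∈ x.sets :=
  ⟨fun h => h.1 (Finset.mem_singleton_self T), fun h =>
    ⟨Finset.singleton_subset_iff.2 h, fun _ => x.mem_of_mem_ones h⟩⟩

/-- Coordinates of values do not depend on the pair. -/
theorem holds_hom_congr {x y : AdmPair n k} {T : x.sets} {S : y.sets} (h : T.1 = S.1)
    (a : Free n k) : Holds T (x.hom.toFun a) ↔ Holds S (y.hom.toFun a) := by
  obtain ⟨t, rfl⟩ := Free.exists_rep a
  exact holds_eval_congr (fun i => by rw [holds_assign, holds_assign, h]) t

/-- A pair `x` forces `a` if the homomorphism of `x` sends `a` to `1`. Admissible pairs are thus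
points of a Kripke model for the elements of the free algebra. -/
def Forces (x : AdmPair n k) (a : Free n k) : Prop := x.hom.toFun a = ⊤

theorem Forces.mono {x y : AdmPair n k} (hxy : x ≤ y) {a : Free n k} (h : x.Forces a) :
    y.Forces a := by
  obtain ⟨t, rfl⟩ := Free.exists_rep a
  refine eval_eq_top_mono (fun i hi => assign_eq_top.2 (hxy.2 (assign_eq_top.1 hi)))
    (fun S => ⟨⟨S.1, hxy.1 S.2⟩, fun i => ?_⟩) t h
  rw [holds_assign, holds_assign]

theorem not_forces_bot (x : AdmPair n k) : ¬x.Forces ⊥ := fun h =>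
  have h' : (⊥ : BBar x.sets) = ⊤ := x.hom.map_bot.symm.trans h
  not_holds_bot (Classical.arbitrary x.sets) (h' ▸ holds_top _)

theorem forces_top (x : AdmPair n k) : x.Forces ⊤ := x.hom.map_top

theorem forces_inf {x : AdmPair n k} {a b : Free n k} :
    x.Forces (a ⊓ b) ↔ x.Forces a ∧ x.Forces b := by
  rw [Forces, x.hom.map_inf, inf_eq_top_iff]
  rfl

theorem forces_sup {x : AdmPair n k} {a b : Free n k} :
    x.Forces (a ⊔ b) ↔ x.Forces a ∨ x.Forces b := by
  rw [Forces, x.hom.map_sup, sup_eq_top_iff]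
  rfl

theorem forces_gen {x : AdmPair n k} {i : Fin k} : x.Forces (Free.gen i) ↔ i ∈ x.ones :=
  assign_eq_top

theorem forces_finset_inf {x : AdmPair n k} {α : Type*} {s : Finset α} {f : α → Free n k} :
    x.Forces (s.inf f) ↔ ∀ i ∈ s, x.Forces (f i) := by
  classical
  induction s using Finset.induction with
  | empty => simpa using x.forces_top
  | insert i s _ ih => rw [Finset.inf_insert, forces_inf, ih, Finset.forall_mem_insert]

theorem forces_finset_sup {x : AdmPair n k} {α : Type*} {s : Finset α} {f : α → Free n k} :
    x.Forces (s.sup f) ↔ ∃ i ∈ s, x.Forces (f i) := by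
  classical
  induction s using Finset.induction with
  | empty => simpa using x.not_forces_bot
  | insert i s _ ih => rw [Finset.sup_insert, forces_sup, ih, Finset.exists_mem_insert]

/-- At a pair `({T}, T)` no generator is sent to the top of the Boolean algebra, so the values are
`0` and `1` only. -/
theorem forces_single_iff {hn : 1 ≤ n} {T : Finset (Fin k)} {S : (single hn T).sets}
    {a : Free n k} : (single hn T).Forces a ↔ Holds S ((single hn T).hom.toFun a) := by
  have hS : S.1 = T := Finset.mem_singleton.1 S.2
  have huniq : ∀ S' : (single hn T).sets, S' = S := fun S' =>
    Subtype.ext ((Finset.mem_singleton.1 S'.2).trans hS.symm)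
  obtain ⟨t, rfl⟩ := Free.exists_rep a
  change t.eval _ = ⊤ ↔ Holds S (t.eval _)
  induction t with
  | var i =>
    refine assign_eq_top.trans ((holds_assign _ S i).trans ?_).symm
    rw [hS]
    rfl
  | bot => exact iff_of_false (not_forces_bot (single hn T)) (not_holds_bot S)
  | top => exact iff_of_true rfl (holds_top S)
  | inf s t hs ht => exact inf_eq_top_iff.trans ((and_congr hs ht).trans holds_inf.symm)
  | sup s t hs ht => exact sup_eq_top_iff.trans ((or_congr hs ht).trans holds_sup.symm)
  | compl t _ =>
    refine compl_eq_top_iff.trans ⟨fun h => holds_compl.2 (h S), fun h S' => ?_⟩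
    rw [huniq S']
    exact holds_compl.1 h

theorem holds_hom_iff (hn : 1 ≤ n) {x : AdmPair n k} {T : x.sets} {a : Free n k} :
    Holds T (x.hom.toFun a) ↔ (single hn T.1).Forces a :=
  let S : (single hn T.1).sets := ⟨T.1, Finset.mem_singleton_self T.1⟩
  (holds_hom_congr (T := T) (S := S) rfl a).trans (forces_single_iff (S := S)).symm

theorem forces_compl_iff_single (hn : 1 ≤ n) {x : AdmPair n k} {a : Free n k} :
    x.Forces aᶜ ↔ ∀ T ∈ x.sets, ¬(single hn T).Forces a := by
  rw [Forces, x.hom.map_compl, compl_eq_top_iff, Subtype.forall]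
  simp_rw [holds_hom_iff hn]

theorem single_forces_compl (hn : 1 ≤ n) {T : Finset (Fin k)} {a : Free n k} :
    (single hn T).Forces aᶜ ↔ ¬(single hn T).Forces a := by
  rw [forces_compl_iff_single hn]
  exact ⟨fun h => h T (Finset.mem_singleton_self T), fun h S hS => by
    rwa [Finset.mem_singleton.1 hS]⟩

/-- The Kripke clause for the pseudo-complement. -/
theorem forces_compl (hn : 1 ≤ n) {x : AdmPair n k} {a : Free n k} :
    x.Forces aᶜ ↔ ∀ y, x ≤ y → ¬y.Forces a := by
  refine ⟨fun h y hxy hy => ?_, fun h => ?_⟩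
  · have hbot : a ⊓ aᶜ = ⊥ := by
      rw [inf_comm]
      exact (PAlgebra.le_compl_iff' _ _).1 le_rfl
    exact y.not_forces_bot (hbot ▸ forces_inf.2 ⟨hy, h.mono hxy⟩)
  · exact (forces_compl_iff_single hn).2 fun T hT => h _ (le_single_iff.2 hT)

theorem single_forces_atomOf (hn : 1 ≤ n) {S T : Finset (Fin k)} :
    (single hn S).Forces (atomOf n T) ↔ S = T := by
  rw [atomOf, forces_inf, forces_finset_inf, forces_finset_inf]
  simp_rw [single_forces_compl, forces_gen, Finset.mem_compl]
  refine ⟨fun h => Finset.Subset.antisymm (fun i hi => ?_) fun i hi => h.1 i hi, ?_⟩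
  · by_contra hT
    exact h.2 i hT hi
  · rintro rfl
    exact ⟨fun _ => id, fun _ => id⟩

/-- `p^L_𝒯` is forced exactly on the principal up-set of `(𝒯, L)`. -/
theorem forces_pElem (hn : 1 ≤ n) {x y : AdmPair n k} :
    y.Forces (pElem n x.sets x.ones) ↔ x ≤ y := by
  rw [pElem, forces_inf, forces_finset_inf, forces_compl_iff_single hn]
  simp_rw [single_forces_compl, not_not, forces_finset_sup, single_forces_atomOf, forces_gen,
    exists_eq_right']
  exact Iff.rfl

/-- An element is determined by the pairs that force it. Given elements that differ under an
assignment in `BBar (Fin n)`, let `𝒯` be the set of its Boolean coordinates and `L` the set of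
generators sent to `1`: the pair `(𝒯, L)`, or one of the pairs `({T}, T)` above it, forces only one
of the elements. -/
theorem eq_of_forces_iff (hn : 1 ≤ n) {a b : Free n k}
    (h : ∀ x : AdmPair n k, x.Forces a ↔ x.Forces b) : a = b := by
  classical
  obtain ⟨s, rfl⟩ := Free.exists_rep a
  obtain ⟨t, rfl⟩ := Free.exists_rep b
  rw [Free.mk_eq]
  intro v
  have : Nonempty (Fin n) := ⟨⟨0, hn⟩⟩
  let T : Fin n → Finset (Fin k) := fun u => Finset.univ.filter fun i => Holds u (v i)
  obtain ⟨x, hsets, hones⟩ : ∃ x : AdmPair n k,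
      x.sets = Finset.univ.image T ∧ x.ones = Finset.univ.filter fun i => v i = ⊤ := by
    refine ⟨⟨_, _, Finset.card_pos.2 (Finset.univ_nonempty.image T),
      Finset.card_image_le.trans (by simp), Finset.le_inf fun S hS i hi => ?_⟩, rfl, rfl⟩
    obtain ⟨u, -, rfl⟩ := Finset.mem_image.1 hS
    have hi' : v i = ⊤ := (Finset.mem_filter.1 hi).2
    exact Finset.mem_filter.2 ⟨Finset.mem_univ i, hi' ▸ holds_top u⟩
  have hx : ∀ u, T u ∈ x.sets := fun u =>
    hsets ▸ Finset.mem_image_of_mem T (Finset.mem_univ u)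
  have htop : ∀ i, v i = ⊤ ↔ assign x.sets x.ones i = ⊤ := fun i =>
    (assign_eq_top.trans (by simp [hones])).symm
  have hcoord : ∀ (u : Fin n) (S : x.sets), S.1 = T u → ∀ i,
      Holds u (v i) ↔ Holds S (assign x.sets x.ones i) := fun u S hS i => by
    rw [holds_assign, hS]
    simp [T]
  have heval : ∀ r : Term (Fin k), r.eval v = ⊤ ↔ x.Forces (Free.mk r) := fun r =>
    ⟨eval_eq_top_mono (fun i => (htop i).1) (fun S => by
        obtain ⟨u, -, hu⟩ := Finset.mem_image.1 (hsets.subset S.2)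
        exact ⟨u, hcoord u S hu.symm⟩) r,
      eval_eq_top_mono (fun i => (htop i).2) (fun u =>
        ⟨⟨T u, hx u⟩, fun i => (hcoord u _ rfl i).symm⟩) r⟩
  refine bBar_ext ((heval s).trans ((h x).trans (heval t).symm)) fun u => ?_
  have hu : ∀ r : Term (Fin k), Holds u (r.eval v) ↔ (single hn (T u)).Forces (Free.mk r) :=
    fun r => (holds_eval_congr (hcoord u ⟨T u, hx u⟩ rfl) r).trans
      (holds_hom_iff (a := Free.mk r) hn)
  exact (hu s).trans ((h _).trans (hu t).symm)

theorem le_of_forces_imp (hn : 1 ≤ n) {a b : Free n k}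
    (h : ∀ x : AdmPair n k, x.Forces a → x.Forces b) : a ≤ b :=
  inf_eq_left.1 <| eq_of_forces_iff hn fun x => forces_inf.trans (and_iff_left_of_imp (h x))

theorem Forces.of_le {x : AdmPair n k} {a b : Free n k} (h : x.Forces a) (hab : a ≤ b) :
    x.Forces b := by
  rw [← inf_eq_left.2 hab, forces_inf] at h
  exact h.2

theorem pElem_le_iff (hn : 1 ≤ n) {x : AdmPair n k} {a : Free n k} :
    pElem n x.sets x.ones ≤ a ↔ x.Forces a :=
  ⟨((forces_pElem hn).2 le_rfl).of_le, fun h =>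
    le_of_forces_imp hn fun _ hy => h.mono ((forces_pElem hn).1 hy)⟩

end AdmPair

/-! ### The free algebra as an algebra of up-sets -/

section

variable {n k : ℕ}

open AdmPair

theorem Free.finite (hn : 1 ≤ n) : Finite (Free n k) :=
  Finite.of_injective (fun a => {x : AdmPair n k | x.Forces a}) fun _ _ h =>
    eq_of_forces_iff hn fun x => Set.ext_iff.1 h x

/-- Every up-set of pairs is the union of the principal up-sets of its points, so it consists
of the pairs that force a join of elements `p^L_𝒯`. -/
theorem exists_forces_iff_mem (hn : 1 ≤ n) {U : Set (AdmPair n k)} (hU : IsUpperSet U) :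
    ∃ a : Free n k, ∀ x : AdmPair n k, x.Forces a ↔ x ∈ U := by
  classical
  refine ⟨(Finset.univ.filter (· ∈ U)).sup fun x => pElem n x.sets x.ones, fun y => ?_⟩
  simp_rw [forces_finset_sup, forces_pElem hn, Finset.mem_filter, Finset.mem_univ, true_and]
  exact ⟨fun ⟨x, hx, hxy⟩ => hU hxy hx, fun hy => ⟨y, hy, le_rfl⟩⟩

/-- The free algebra is isomorphic to the algebra of up-sets of any quasi-ordered set that is
equivalent to the ordered set of admissible pairs. -/
theorem iso_up_of_surjective (hn : 1 ≤ n) {Y : Type*} [Preorder Y] (e : AdmPair n k → Y)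
    (hle : ∀ x y, e x ≤ e y ↔ x ≤ y) (he : Function.Surjective e) : Iso (Free n k) (Up Y) := by
  let S : Free n k → Set Y := fun a => e '' {x | x.Forces a}
  have hS : ∀ a x, e x ∈ S a ↔ x.Forces a := fun a x =>
    ⟨fun ⟨y, hy, hyx⟩ => Forces.mono ((hle y x).1 hyx.le) hy, fun h => ⟨x, h, rfl⟩⟩
  have hup : ∀ a, IsUpperSet (S a) := by
    rintro a y z hyz ⟨x, hx, rfl⟩
    obtain ⟨z, rfl⟩ := he z
    exact (hS a z).2 (Forces.mono ((hle x z).1 hyz) hx)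
  refine ⟨{ toFun := fun a => ⟨S a, hup a⟩
            map_bot := ?_, map_top := ?_, map_inf := ?_, map_sup := ?_, map_compl := ?_ }, ?_, ?_⟩
  · refine Subtype.ext (Set.ext fun y => ?_)
    obtain ⟨x, rfl⟩ := he y
    exact (hS _ x).trans (iff_of_false x.not_forces_bot id)
  · refine Subtype.ext (Set.ext fun y => ?_)
    obtain ⟨x, rfl⟩ := he y
    exact (hS _ x).trans (iff_of_true x.forces_top trivial)
  · refine fun a b => Subtype.ext (Set.ext fun y => ?_)
    obtain ⟨x, rfl⟩ := he y
    exact (hS _ x).trans (forces_inf.trans (and_congr (hS a x) (hS b x)).symm)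
  · refine fun a b => Subtype.ext (Set.ext fun y => ?_)
    obtain ⟨x, rfl⟩ := he y
    exact (hS _ x).trans (forces_sup.trans (or_congr (hS a x) (hS b x)).symm)
  · refine fun a => Subtype.ext (Set.ext fun y => ?_)
    obtain ⟨x, rfl⟩ := he y
    refine (hS _ x).trans ((forces_compl hn).trans ?_)
    change _ ↔ ¬∃ z ∈ S a, e x ≤ z
    rw [not_exists, he.forall]
    refine forall_congr' fun z => ?_
    rw [hS, hle, not_and']
  · intro a b h
    refine eq_of_forces_iff hn fun x => ?_
    rw [← hS, ← hS]
    exact Set.ext_iff.1 (congrArg Subtype.val h) (e x)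
  · rintro ⟨V, hV⟩
    obtain ⟨a, ha⟩ := exists_forces_iff_mem (U := e ⁻¹' V) hn fun x y hxy hx =>
      hV ((hle x y).2 hxy) hx
    refine ⟨a, Subtype.ext (Set.ext fun y => ?_)⟩
    obtain ⟨x, rfl⟩ := he y
    exact (hS a x).trans (ha x)

/-! ### Join-irreducible elements and prime filters -/

theorem supPrime_pElem (hn : 1 ≤ n) (x : AdmPair n k) : SupPrime (pElem n x.sets x.ones) := by
  refine ⟨fun h => x.not_forces_bot ((pElem_le_iff hn).1 (h bot_le)), fun a b h => ?_⟩
  rw [pElem_le_iff hn] at h ⊢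
  rw [pElem_le_iff hn]
  exact forces_sup.1 h

theorem supIrred_iff (hn : 1 ≤ n) {p : Free n k} :
    SupIrred p ↔ ∃ x : AdmPair n k, p = pElem n x.sets x.ones := by
  classical
  refine ⟨fun hp => ?_, ?_⟩
  · have h : (Finset.univ.filter fun x : AdmPair n k => x.Forces p).sup
        (fun x => pElem n x.sets x.ones) = p := by
      refine eq_of_forces_iff hn fun y => ?_
      simp_rw [forces_finset_sup, forces_pElem hn, Finset.mem_filter, Finset.mem_univ, true_and]
      exact ⟨fun ⟨x, hx, hxy⟩ => hx.mono hxy, fun hy => ⟨y, hy, le_rfl⟩⟩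
    obtain ⟨x, -, hx⟩ := hp.finset_sup_eq h
    exact ⟨x, hx.symm⟩
  · rintro ⟨x, rfl⟩
    exact (supPrime_pElem hn x).supIrred

theorem isPrime_principal_pElem (hn : 1 ≤ n) (x : AdmPair n k) :
    (Order.PFilter.principal (pElem n x.sets x.ones)).IsPrime := by
  refine ⟨⟨fun a b hba ha hb => ha ?_, ⟨⊥, fun h => ?_⟩, fun a ha b hb =>
    ⟨a ⊔ b, fun h => ?_, le_sup_left, le_sup_right⟩⟩⟩
  · exact Order.PFilter.mem_of_le hba hb
  · exact (supPrime_pElem hn x).1 fun _ _ => (Order.PFilter.mem_principal.1 h).trans bot_le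
  · exact ((supPrime_pElem hn x).2 (Order.PFilter.mem_principal.1 h)).elim
      (fun h => ha (Order.PFilter.mem_principal.2 h)) fun h => hb (Order.PFilter.mem_principal.2 h)

/-- A prime filter of the finite free algebra is generated by the meet of its elements, which is
join-irreducible. -/
theorem exists_principal_pElem_eq (hn : 1 ≤ n) {F : Order.PFilter (Free n k)} (hF : F.IsPrime) :
    ∃ x : AdmPair n k, Order.PFilter.principal (pElem n x.sets x.ones) = F := by
  classical
  have := Free.finite (k := k) hn
  have := Fintype.ofFinite (Free n k)
  set m : Free n k := (Finset.univ.filter (· ∈ F)).inf id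
  have hmF : m ∈ F := Finset.inf_induction Order.PFilter.top_mem
    (fun _ ha _ hb => Order.PFilter.inf_mem ha hb) fun a ha => (Finset.mem_filter.1 ha).2
  have hmem : ∀ a, a ∈ F ↔ m ≤ a := fun a =>
    ⟨fun ha => Finset.inf_le (f := id) (Finset.mem_filter.2 ⟨Finset.mem_univ a, ha⟩),
      fun h => Order.PFilter.mem_of_le h hmF⟩
  have hirr : SupIrred m := by
    refine SupPrime.supIrred ⟨fun h => ?_, fun a b h => ?_⟩
    · obtain ⟨c, hc⟩ := hF.compl_ideal.Nonempty
      exact hc ((hmem c).2 ((h bot_le).trans bot_le))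
    · by_contra! hab
      have : a ⊔ b ∈ hF.compl_ideal.toIdeal :=
        Order.Ideal.sup_mem (fun h => hab.1 ((hmem a).1 h)) fun h => hab.2 ((hmem b).1 h)
      exact this ((hmem _).2 h)
  obtain ⟨x, hx⟩ := (supIrred_iff hn).1 hirr
  refine ⟨x, SetLike.ext fun a => ?_⟩
  rw [Order.PFilter.mem_principal, hmem, hx]

/-! ### Completely meet-irreducible congruences -/

namespace AdmPair

/-- The congruence `μ^L_𝒯` of the pair `(𝒯, L)`. -/
noncomputable abbrev con (x : AdmPair n k) : Con (Free n k) := mu x.adm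

theorem mem_oneClass_con {x : AdmPair n k} {a : Free n k} : a ∈ x.con.oneClass ↔ x.Forces a := by
  change x.hom.toFun a = x.hom.toFun ⊤ ↔ _
  rw [x.hom.map_top]
  rfl

theorem oneClass_con_subset_iff (hn : 1 ≤ n) {x y : AdmPair n k} :
    x.con.oneClass ⊆ y.con.oneClass ↔ x ≤ y := by
  simp_rw [Set.subset_def, mem_oneClass_con]
  exact ⟨fun h => (forces_pElem hn).1 (h _ ((forces_pElem hn).2 le_rfl)), fun h _ => Forces.mono h⟩

/-- A congruence that relates two elements with different images under the homomorphism of `x`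
relates an element that `x` forces with one that it does not force. -/
theorem exists_forces_not_forces (hn : 1 ≤ n) {x : AdmPair n k} {φ : Con (Free n k)}
    {a b : Free n k} (h : φ.rel a b) (hab : x.hom.toFun a ≠ x.hom.toFun b) :
    ∃ c d, φ.rel c d ∧ x.Forces c ∧ ¬x.Forces d := by
  by_cases htop : x.Forces a ↔ x.Forces b
  · obtain ⟨T, hT⟩ : ∃ T, ¬(Holds T (x.hom.toFun a) ↔ Holds T (x.hom.toFun b)) := by
      by_contra! h'
      exact hab (bBar_ext htop h')
    -- Meeting with `x_T` isolates the coordinate `T` in which `a` and `b` differ.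
    have key : ∀ {a b : Free n k}, φ.rel a b → Holds T (x.hom.toFun a) →
        ¬Holds T (x.hom.toFun b) → ∃ c d, φ.rel c d ∧ x.Forces c ∧ ¬x.Forces d := by
      intro a b h ha hb
      rw [holds_hom_iff hn] at ha hb
      refine ⟨(b ⊓ atomOf n T.1)ᶜ, (a ⊓ atomOf n T.1)ᶜ,
        φ.compl (φ.inf (φ.iseqv.symm h) (φ.iseqv.refl _)), ?_, ?_⟩
      · rw [forces_compl_iff_single hn]
        intro S _ hS
        rw [forces_inf, single_forces_atomOf] at hS
        exact hb (hS.2 ▸ hS.1)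
      · rw [forces_compl_iff_single hn]
        exact fun h => h T.1 T.2 (forces_inf.2 ⟨ha, (single_forces_atomOf hn).2 rfl⟩)
    by_cases ha : Holds T (x.hom.toFun a)
    · exact key h ha fun hb => hT (iff_of_true ha hb)
    · exact key (φ.iseqv.symm h) (by_contra fun hb => hT (iff_of_false ha hb)) ha
  · by_cases ha : x.Forces a
    · exact ⟨a, b, h, ha, fun hb => htop (iff_of_true ha hb)⟩
    · exact ⟨b, a, φ.iseqv.symm h, by_contra fun hb => htop (iff_of_false ha hb), ha⟩

/-- The image of the free algebra in `BBar 𝒯` has a largest element below `1`, the image of `d`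
say. All congruences properly above the kernel relate `d` and `1`. -/
theorem completelyMeetIrred_con (hn : 1 ≤ n) (x : AdmPair n k) : CompletelyMeetIrred x.con := by
  classical
  have := Free.finite (k := k) hn
  have := Fintype.ofFinite (Free n k)
  intro S hS
  by_contra hx
  set d : Free n k := (Finset.univ.filter fun a => ¬x.Forces a).sup id with hd
  have hd_not : ¬x.Forces d := by
    rw [hd, forces_finset_sup]
    rintro ⟨a, ha, h⟩
    exact (Finset.mem_filter.1 ha).2 h
  have hle : ∀ a, ¬x.Forces a → a ≤ d := fun a ha =>
    Finset.le_sup (f := id) (Finset.mem_filter.2 ⟨Finset.mem_univ a, ha⟩)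
  have hrel : ∀ φ ∈ S, φ.rel d ⊤ := by
    intro φ hφ
    have hxφ : x.con ≤ φ := hS ▸ sInf_le hφ
    obtain ⟨a, b, hab, hne⟩ : ∃ a b, φ.rel a b ∧ x.hom.toFun a ≠ x.hom.toFun b := by
      by_contra! h
      exact hx (le_antisymm hxφ (fun a b hab => h a b hab : φ ≤ x.con) ▸ hφ)
    obtain ⟨p, q, hpq, hp, hq⟩ := exists_forces_not_forces hn hab hne
    have h₁ : φ.rel (p ⊔ d) d := by
      have := φ.sup hpq (φ.iseqv.refl d)
      rwa [sup_eq_right.2 (hle q hq)] at this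
    have h₂ : φ.rel (p ⊔ d) ⊤ := hxφ _ _ (mem_oneClass_con.2 (forces_sup.2 (Or.inl hp)))
    exact φ.iseqv.trans (φ.iseqv.symm h₁) h₂
  have : (sInf S).rel d ⊤ := hrel
  rw [hS] at this
  exact hd_not (mem_oneClass_con.1 this)

/-- If `μ` does not put `a` below `b`, some `p^L_𝒯` generates a filter that is a union of classes
of `μ`, and `p^L_𝒯` is not below `b` modulo `μ`; hence `μ` lies below the kernel `μ^L_𝒯`, which
does not put `a` below `b` either. -/
theorem exists_le_con_of_not_rel (hn : 1 ≤ n) {μ : Con (Free n k)} {a b : Free n k}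
    (h : ¬μ.rel (a ⊓ b) a) : ∃ x : AdmPair n k, μ ≤ x.con ∧ x.Forces a ∧ ¬x.Forces b := by
  have := Free.finite (k := k) hn
  obtain ⟨p, ⟨hpa, hpb⟩, hmin⟩ :=
    (Set.toFinite {c : Free n k | c ≤ a ∧ ¬μ.rel (c ⊓ b) c}).exists_minimal ⟨a, le_rfl, h⟩
  have hmin' : ∀ c, c ≤ p → ¬μ.rel (c ⊓ b) c → p ≤ c := fun c hc hcb =>
    hmin ⟨hc.trans hpa, hcb⟩ hc
  have hirr : SupIrred p := by
    refine ⟨fun hbot => hpb ?_, fun q r hqr => ?_⟩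
    · rw [inf_eq_left.2 ((hbot bot_le).trans bot_le)]
      exact μ.iseqv.refl p
    · by_contra! hne
      have hlt : ∀ c, c ≤ p → c ≠ p → μ.rel (c ⊓ b) c := fun c hc hcp => by
        by_contra hcb
        exact hcp (hc.antisymm (hmin' c hc hcb))
      refine hpb ?_
      rw [← hqr, inf_sup_right]
      exact μ.sup (hlt q (hqr ▸ le_sup_left) hne.1) (hlt r (hqr ▸ le_sup_right) hne.2)
  obtain ⟨x, rfl⟩ := (supIrred_iff hn).1 hirr
  have hsat : ∀ {c d : Free n k}, μ.rel c d → x.Forces c → x.Forces d := by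
    intro c d hcd hc
    rw [← pElem_le_iff hn] at hc ⊢
    set p := pElem n x.sets x.ones
    have hpd : μ.rel (p ⊓ d) p := by
      have := μ.inf (μ.iseqv.refl p) (μ.iseqv.symm hcd)
      rwa [inf_eq_left.2 hc] at this
    refine (hmin' (p ⊓ d) inf_le_left fun h' => hpb ?_).trans inf_le_right
    exact μ.iseqv.trans (μ.iseqv.symm (μ.inf hpd (μ.iseqv.refl b))) (μ.iseqv.trans h' hpd)
  refine ⟨x, fun c d hcd => ?_, (pElem_le_iff hn).1 hpa, fun hb => hpb ?_⟩
  · by_contra hne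
    obtain ⟨c', d', hrel, hc', hd'⟩ := exists_forces_not_forces hn hcd hne
    exact hd' (hsat hrel hc')
  · rw [inf_eq_left.2 ((pElem_le_iff hn).2 hb)]
    exact μ.iseqv.refl _

theorem completelyMeetIrred_iff (hn : 1 ≤ n) {μ : Con (Free n k)} :
    CompletelyMeetIrred μ ↔ ∃ x : AdmPair n k, μ = x.con := by
  refine ⟨fun hμ => ?_, ?_⟩
  · have hmem : μ ∈ {φ | μ ≤ φ ∧ ∃ x : AdmPair n k, φ = x.con} := by
      refine hμ _ (le_antisymm (fun a b hab => ?_) (le_sInf fun φ hφ => hφ.1))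
      have hcon : ∀ x : AdmPair n k, μ ≤ x.con → (x.Forces a ↔ x.Forces b) := fun x hx => by
        have : x.hom.toFun a = x.hom.toFun b := hab _ ⟨hx, x, rfl⟩
        rw [Forces, Forces, this]
      have h₁ : μ.rel (a ⊓ b) a := by
        by_contra h
        obtain ⟨x, hx, ha, hb⟩ := exists_le_con_of_not_rel hn h
        exact hb ((hcon x hx).1 ha)
      have h₂ : μ.rel (b ⊓ a) b := by
        by_contra h
        obtain ⟨x, hx, hb, ha⟩ := exists_le_con_of_not_rel hn h
        exact ha ((hcon x hx).2 hb)
      rw [inf_comm] at h₂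
      exact μ.iseqv.trans (μ.iseqv.symm h₁) h₂
    exact hmem.2
  · rintro ⟨x, rfl⟩
    exact completelyMeetIrred_con hn x

end AdmPair

end

end PAlg

theorem mainTheorem1 (n k : ℕ) (hn : 1 ≤ n) :
    ({μ : PAlg.Con (PAlg.Free n k) | PAlg.CompletelyMeetIrred μ} =
      {μ | ∃ (𝒯 : Finset (Finset (Fin k))) (L : Finset (Fin k)) (h : PAlg.Admissible n 𝒯 L),
        μ = PAlg.mu h}) ∧
    (∀ (μ ν : PAlg.Cm (PAlg.Free n k)) (𝒯 𝒮 : Finset (Finset (Fin k))) (L K : Finset (Fin k))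
      (hT : PAlg.Admissible n 𝒯 L) (hS : PAlg.Admissible n 𝒮 K),
      μ.con = PAlg.mu hT → ν.con = PAlg.mu hS → (μ ≤ ν ↔ 𝒮 ⊆ 𝒯 ∧ L ⊆ K)) ∧
    ({p : PAlg.Free n k | SupIrred p} =
      {p | ∃ (𝒯 : Finset (Finset (Fin k))) (L : Finset (Fin k)),
        PAlg.Admissible n 𝒯 L ∧ p = PAlg.pElem n 𝒯 L}) ∧
    PAlg.Iso (PAlg.Free n k) (PAlg.Up (PAlg.PrimeFilter (PAlg.Free n k))) ∧
    PAlg.Iso (PAlg.Free n k) (PAlg.Up (PAlg.Cm (PAlg.Free n k))) ∧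
    PAlg.Iso (PAlg.Free n k) (PAlg.Up ((PAlg.JoinIrred (PAlg.Free n k))ᵒᵈ)) := by
  have hp : ∀ x y : PAlg.AdmPair n k,
      PAlg.pElem n y.sets y.ones ≤ PAlg.pElem n x.sets x.ones ↔ x ≤ y := fun x y => by
    rw [PAlg.AdmPair.pElem_le_iff hn, PAlg.AdmPair.forces_pElem hn]
  refine ⟨Set.ext fun μ => ?_, ?_, Set.ext fun p => ?_, ?_, ?_, ?_⟩
  · refine (PAlg.AdmPair.completelyMeetIrred_iff hn).trans ⟨?_, ?_⟩
    · rintro ⟨x, hx⟩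
      exact ⟨x.sets, x.ones, x.adm, hx⟩
    · rintro ⟨𝒯, L, h, hμ⟩
      exact ⟨⟨𝒯, L, h⟩, hμ⟩
  · intro μ ν 𝒯 𝒮 L K hT hS hμ hν
    change μ.con.oneClass ⊆ ν.con.oneClass ↔ _
    rw [hμ, hν]
    exact PAlg.AdmPair.oneClass_con_subset_iff hn (x := ⟨𝒯, L, hT⟩) (y := ⟨𝒮, K, hS⟩)
  · refine (PAlg.supIrred_iff hn).trans ⟨?_, ?_⟩
    · rintro ⟨x, hx⟩
      exact ⟨x.sets, x.ones, x.adm, hx⟩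
    · rintro ⟨𝒯, L, h, hp⟩
      exact ⟨⟨𝒯, L, h⟩, hp⟩
  · refine PAlg.iso_up_of_surjective hn
      (fun x => ⟨Order.PFilter.principal _, PAlg.isPrime_principal_pElem hn x⟩)
      (fun x y => Order.PFilter.principal_le_principal_iff.trans (hp x y)) ?_
    rintro ⟨F, hF⟩
    obtain ⟨x, hx⟩ := PAlg.exists_principal_pElem_eq hn hF
    exact ⟨x, Subtype.ext hx⟩
  · refine PAlg.iso_up_of_surjective hn
      (fun x => ⟨x.con, PAlg.AdmPair.completelyMeetIrred_con hn x⟩)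
      (fun x y => PAlg.AdmPair.oneClass_con_subset_iff hn) ?_
    rintro ⟨μ, hμ⟩
    obtain ⟨x, rfl⟩ := (PAlg.AdmPair.completelyMeetIrred_iff hn).1 hμ
    exact ⟨x, rfl⟩
  · refine PAlg.iso_up_of_surjective hn
      (fun x => OrderDual.toDual ⟨_, (PAlg.supPrime_pElem hn x).supIrred⟩) hp ?_
    rintro ⟨p, hirr⟩
    obtain ⟨x, rfl⟩ := (PAlg.supIrred_iff hn).1 hirr
    exact ⟨x, rfl⟩
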